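/- Let $m,n,p$ be nonnegative integers, fix a matrix $D\in\mathbb{R}^{m\times p}$ and $\lambda>0$, and let $X\in\mathbb{R}^{n\times p}$, $y\in\mathbb{R}^n$ be random, with the joint distribution of $(X,y)$ absolutely continuous with respect to $(np+n)$-dimensional Lebesgue measure. Let $\mathbf 1\in\mathbb{R}^n$ be the all-ones vector, $M=I-\mathbf 1\mathbf 1^T/n\in\mathbb{R}^{n\times n}$ the centering matrix, and $\mathrm{nullity}(D)=\dim\{\beta\in\mathbb{R}^p: D\beta=0\}$. Assume that either $p\le n-1$, or $p>n-1$ and $\mathrm{nullity}(D)\le n-1$. Then: (a) almost surely, the centered generalized lasso problem $$\min_{\beta\in\mathbb{R}^p}\ \tfrac12\|y-MX\beta\|_2^2+\lambda\|D\beta\|_1$$ has exactly one solution $\beta$; (b) almost surely, the generalized lasso problem with an unpenalized intercept $$\min_{\beta_0\in\mathbb{R},\ \beta\in\mathbb{R}^p}\ \tfrac12\|y-\beta_0\mathbf 1-X\beta\|_2^2+\lambda\|D\beta\|_1$$ has exactly one solution $(\beta_0,\beta)$. -/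

import Mathlib

open MeasureTheory

noncomputable section

namespace GenLasso

/-- The nullity of a matrix: the dimension of its null space `{β | D β = 0}`. -/
def nullity {m p : ℕ} (D : Matrix (Fin m) (Fin p) ℝ) : ℕ :=
  Module.finrank ℝ (LinearMap.ker D.mulVecLin)

/-- The squared Euclidean norm `‖v‖₂²`. -/
def sqNorm {n : ℕ} (v : Fin n → ℝ) : ℝ := ∑ i, v i ^ 2

/-- The `ℓ₁` norm `‖v‖₁`. -/
def l1Norm {m : ℕ} (v : Fin m → ℝ) : ℝ := ∑ i, |v i|

/-- The centering matrix `M = I - 𝟙 𝟙ᵀ / n`. -/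
def centering (n : ℕ) : Matrix (Fin n) (Fin n) ℝ :=
  1 - (n : ℝ)⁻¹ • Matrix.vecMulVec 1 1

/-- The generalized lasso criterion `(1/2) ‖y - A β‖₂² + lam ‖D β‖₁`, with response `y`,
predictor matrix `A`, penalty matrix `D` and tuning parameter `lam`. -/
def criterion {m n p : ℕ} (D : Matrix (Fin m) (Fin p) ℝ) (lam : ℝ)
    (A : Matrix (Fin n) (Fin p) ℝ) (y : Fin n → ℝ) (β : Fin p → ℝ) : ℝ :=
  1 / 2 * sqNorm (y - A.mulVec β) + lam * l1Norm (D.mulVec β)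

/-- `β` is a solution of the centered generalized lasso problem, i.e. a global minimizer of
`(1/2) ‖y - M X β‖₂² + lam ‖D β‖₁` over `β ∈ ℝᵖ`. -/
def IsCenteredSolution {m n p : ℕ} (D : Matrix (Fin m) (Fin p) ℝ) (lam : ℝ)
    (X : Matrix (Fin n) (Fin p) ℝ) (y : Fin n → ℝ) (β : Fin p → ℝ) : Prop :=
  ∀ β' : Fin p → ℝ,
    criterion D lam (centering n * X) y β ≤ criterion D lam (centering n * X) y β'

/-- The criterion `(1/2) ‖y - β₀ 𝟙 - X β‖₂² + lam ‖D β‖₁` of the generalized lasso problem with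
an unpenalized intercept. -/
def interceptCriterion {m n p : ℕ} (D : Matrix (Fin m) (Fin p) ℝ) (lam : ℝ)
    (X : Matrix (Fin n) (Fin p) ℝ) (y : Fin n → ℝ) (b : ℝ × (Fin p → ℝ)) : ℝ :=
  1 / 2 * sqNorm (y - b.1 • (1 : Fin n → ℝ) - X.mulVec b.2) + lam * l1Norm (D.mulVec b.2)

/-- `b = (β₀, β)` is a solution of the generalized lasso problem with intercept, i.e. a global
minimizer of its criterion over `(β₀, β) ∈ ℝ × ℝᵖ`. -/
def IsInterceptSolution {m n p : ℕ} (D : Matrix (Fin m) (Fin p) ℝ) (lam : ℝ)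
    (X : Matrix (Fin n) (Fin p) ℝ) (y : Fin n → ℝ) (b : ℝ × (Fin p → ℝ)) : Prop :=
  ∀ b' : ℝ × (Fin p → ℝ), interceptCriterion D lam X y b ≤ interceptCriterion D lam X y b'

/-- The pair `(X(ω), y(ω))` as a point of `ℝ^{n × p} × ℝ^n`, the space that carries
`(np + n)`-dimensional Lebesgue measure `volume`. -/
def jointVec {Ω : Type*} {n p : ℕ} (X : Ω → Matrix (Fin n) (Fin p) ℝ) (y : Ω → Fin n → ℝ)
    (ω : Ω) : (Fin n → Fin p → ℝ) × (Fin n → ℝ) :=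
  (fun i j => X ω i j, y ω)

end GenLasso

end

open MeasureTheory Module

namespace GenLasso

/-! ### The centering matrix -/

/-! Only the randomness of `X` matters: for almost every `X` the claim holds for all `y`. Existence
is coercivity, since generically `ker (M X) ⊓ ker D = ⊥`. For uniqueness, strict convexity of the
square forces two minimizers to have equal fits, and their difference lies in `ker (M X) ⊓ U`, where
`U = signSpace D σ` and `σ` is the sign pattern of `D β` at the midpoint `β`. Stationarity of `β`
makes `signFunctional D σ` vanish on that intersection. If the functional is nonzero on `U`, a
dimension count (`ae_ker_inf_eq_bot_of_le_ker`) shows that generically this happens only when the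
intersection is trivial; if it is zero on `U`, then `D β = 0` and `U = ker D`. There are only
finitely many `σ`. The intercept is then profiled out by `interceptCriterion_eq`. -/

/-- The linear functional summing the entries of a vector. -/
def sumFunctional (n : ℕ) : (Fin n → ℝ) →ₗ[ℝ] ℝ := ∑ i, LinearMap.proj i

lemma sumFunctional_apply {n : ℕ} (v : Fin n → ℝ) : sumFunctional n v = ∑ i, v i := by
  simp [sumFunctional]

lemma finrank_ker_sumFunctional {n : ℕ} (hn : 1 ≤ n) :
    finrank ℝ (LinearMap.ker (sumFunctional n)) = n - 1 := by
  have hs : LinearMap.range (sumFunctional n) = ⊤ := by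
    rw [LinearMap.range_eq_top]
    intro c
    exact ⟨Pi.single ⟨0, hn⟩ c, by simp [sumFunctional_apply]⟩
  have h := LinearMap.finrank_range_add_finrank_ker (sumFunctional n)
  rw [hs, finrank_top] at h
  simp only [finrank_self, finrank_fintype_fun_eq_card, Fintype.card_fin] at h
  omega

lemma centering_mulVec_apply {n : ℕ} (v : Fin n → ℝ) (i : Fin n) :
    (centering n).mulVec v i = v i - (n : ℝ)⁻¹ * ∑ j, v j := by
  rw [centering, Matrix.sub_mulVec, Matrix.smul_mulVec, Matrix.one_mulVec]
  simp [Matrix.mulVec, dotProduct]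

lemma centering_mulVec_of_sum_eq_zero {n : ℕ} {v : Fin n → ℝ} (hv : ∑ j, v j = 0) :
    (centering n).mulVec v = v := by
  ext i
  simp [centering_mulVec_apply, hv]

lemma sum_centering_mulVec {n : ℕ} (hn : 1 ≤ n) (v : Fin n → ℝ) :
    ∑ i, (centering n).mulVec v i = 0 := by
  have : (n : ℝ) ≠ 0 := by positivity
  simp only [centering_mulVec_apply, Finset.sum_sub_distrib, Finset.sum_const, Finset.card_univ,
    Fintype.card_fin, nsmul_eq_mul]
  field_simp
  ring

/-! ### Generic injectivity on subspaces -/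

/-- The vanishing of the determinant is avoided almost everywhere by a linear family of
endomorphisms that contains the identity. -/
lemma ae_det_ne_zero {E ι : Type*} [NormedAddCommGroup E] [NormedSpace ℝ E]
    [FiniteDimensional ℝ E] [MeasurableSpace E] [BorelSpace E] (μ : Measure E)
    [μ.IsAddHaarMeasure] [Fintype ι] [DecidableEq ι] (L : E →ₗ[ℝ] Matrix ι ι ℝ) (x₀ : E)
    (hx₀ : L x₀ = 1) : ∀ᵐ x ∂μ, (L x).det ≠ 0 := by
  have hcont : Continuous fun x => (L x).det :=
    (LinearMap.continuous_of_finiteDimensional L).matrix_det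
  have : ProperSpace E := FiniteDimensional.proper ℝ E
  refine ae_mem_of_ae_add_linearMap_mem (LinearMap.toSpanSingleton ℝ E x₀) volume μ
    (s := {x | (L x).det ≠ 0}) (isOpen_ne_fun hcont continuous_const).measurableSet ?_
  -- Along `x + t x₀` the matrix is `L x + t I`, whose determinant is the characteristic polynomial
  -- of `-L x` at `t`: finitely many zeros.
  intro x
  have hfin : {t : ℝ | (-L x).charpoly.IsRoot t}.Finite :=
    Polynomial.finite_setOfPred_isRoot (Matrix.charpoly_monic _).ne_zero
  filter_upwards [hfin.countable.ae_notMem volume] with t ht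
  simp only [Polynomial.IsRoot, Matrix.eval_charpoly] at ht
  simp only [LinearMap.toSpanSingleton_apply, map_add, map_smul, hx₀]
  convert ht using 2
  rw [sub_neg_eq_add, add_comm, Matrix.scalar_apply, ← Matrix.smul_one_eq_diagonal]

/-- The linear map `X ↦ M X` with values in linear maps. -/
noncomputable def centeredLin (n p : ℕ) : (Fin n → Fin p → ℝ) →ₗ[ℝ] ((Fin p → ℝ) →ₗ[ℝ] (Fin n → ℝ)) where
  toFun X := (centering n * Matrix.of X).mulVecLin
  map_add' X Y := by
    rw [← Matrix.mulVecLin_add, ← Matrix.mul_add]; rfl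
  map_smul' c X := by
    ext1 j
    rw [show Matrix.of (c • X) = c • Matrix.of X from rfl, Matrix.mul_smul]
    ext; simp

lemma centeredLin_apply {n p : ℕ} (X : Fin n → Fin p → ℝ) :
    centeredLin n p X = (centering n * Matrix.of X).mulVecLin := rfl

/-- For almost every `X`, the centered matrix `M X` is injective on a given subspace of dimension
at most `n - 1`. -/
lemma ae_ker_inf_eq_bot {n p : ℕ} (hn : 1 ≤ n) (W : Submodule ℝ (Fin p → ℝ))
    (hW : finrank ℝ W ≤ n - 1) :
    ∀ᵐ X : Fin n → Fin p → ℝ, LinearMap.ker (centeredLin n p X) ⊓ W = ⊥ := by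
  -- `M` fixes zero-sum vectors, so embedding `W` into them gives one `X` with `M X` injective on
  -- `W`. Composing with a left inverse `F` turns this `X` into the identity required by
  -- `ae_det_ne_zero`.
  obtain ⟨T, hT⟩ := finrank_le_iff_exists_linearMap.mp
    (hW.trans_eq (finrank_ker_sumFunctional hn).symm)
  obtain ⟨S, hS⟩ := LinearMap.exists_extend ((LinearMap.ker (sumFunctional n)).subtype ∘ₗ T)
  have hX₀ : centeredLin n p (Matrix.of.symm (LinearMap.toMatrix' S)) ∘ₗ W.subtype =
      (LinearMap.ker (sumFunctional n)).subtype ∘ₗ T := by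
    refine LinearMap.ext fun u => ?_
    have h1 : S u = T u := LinearMap.congr_fun hS u
    have h2 : ∑ j, (T u : Fin n → ℝ) j = 0 := by
      rw [← sumFunctional_apply]; exact (T u).2
    have h3 : (LinearMap.toMatrix' S).mulVec (u : Fin p → ℝ) = T u := by
      rw [← h1, LinearMap.toMatrix'_mulVec]
    rw [LinearMap.comp_apply, LinearMap.comp_apply, centeredLin_apply, Matrix.mulVecLin_apply,
      Equiv.apply_symm_apply, ← Matrix.mulVec_mulVec, Submodule.subtype_apply, h3,
      centering_mulVec_of_sum_eq_zero h2]
    rfl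
  obtain ⟨F, hF⟩ := LinearMap.exists_leftInverse_of_injective
    ((LinearMap.ker (sumFunctional n)).subtype ∘ₗ T)
    (LinearMap.ker_eq_bot.mpr (Subtype.val_injective.comp hT))
  let b := finBasis ℝ W
  let L : (Fin n → Fin p → ℝ) →ₗ[ℝ] Matrix (Fin (finrank ℝ W)) (Fin (finrank ℝ W)) ℝ :=
    (LinearMap.toMatrix b b).toLinearMap ∘ₗ LinearMap.llcomp ℝ W (Fin n → ℝ) W F ∘ₗ
      LinearMap.lcomp ℝ (Fin n → ℝ) W.subtype ∘ₗ centeredLin n p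
  have hL : ∀ X, L X = LinearMap.toMatrix b b (F ∘ₗ centeredLin n p X ∘ₗ W.subtype) :=
    fun X => rfl
  have hL₀ : L (Matrix.of.symm (LinearMap.toMatrix' S)) = 1 := by
    rw [hL, hX₀, hF, LinearMap.toMatrix_id]
  filter_upwards [ae_det_ne_zero volume L _ hL₀] with X hX
  rw [hL, LinearMap.det_toMatrix, ne_eq, LinearMap.det_eq_zero_iff_ker_ne_bot, not_not] at hX
  rw [Submodule.eq_bot_iff]
  rintro u ⟨hu, huW⟩
  have : (⟨u, huW⟩ : W) ∈ LinearMap.ker (F ∘ₗ centeredLin n p X ∘ₗ W.subtype) := by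
    have hu0 : centeredLin n p X u = 0 := hu
    simp [LinearMap.mem_ker, hu0]
  rw [hX, Submodule.mem_bot] at this
  exact congrArg Subtype.val this

lemma exists_le_finrank_eq {V : Type*} [AddCommGroup V] [Module ℝ V] (W : Submodule ℝ V)
    [FiniteDimensional ℝ W] {k : ℕ} (hk : k ≤ finrank ℝ W) : ∃ W' ≤ W, finrank ℝ W' = k := by
  have h : finrank ℝ (Fin k → ℝ) ≤ finrank ℝ W := by simpa using hk
  obtain ⟨f, hf⟩ := finrank_le_iff_exists_linearMap.mp h
  refine ⟨LinearMap.range (W.subtype ∘ₗ f), ?_, ?_⟩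
  · rintro _ ⟨x, rfl⟩
    exact (f x).2
  · rw [LinearMap.finrank_range_of_inj (Subtype.val_injective.comp hf)]
    simp

/-- Rank-nullity on `U`: the image of `M X` lies in the zero-sum hyperplane. -/
lemma finrank_le_finrank_ker_inf_add {n p : ℕ} (hn : 1 ≤ n) (X : Fin n → Fin p → ℝ)
    (U : Submodule ℝ (Fin p → ℝ)) :
    finrank ℝ U ≤ finrank ℝ (LinearMap.ker (centeredLin n p X) ⊓ U : Submodule ℝ _) + (n - 1) := by
  have h1 := LinearMap.finrank_range_add_finrank_ker (centeredLin n p X ∘ₗ U.subtype)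
  have h2 : finrank ℝ (LinearMap.range (centeredLin n p X ∘ₗ U.subtype)) ≤ n - 1 := by
    rw [← finrank_ker_sumFunctional hn]
    apply Submodule.finrank_mono
    rintro _ ⟨u, rfl⟩
    rw [LinearMap.mem_ker, sumFunctional_apply, LinearMap.comp_apply, centeredLin_apply,
      Matrix.mulVecLin_apply, ← Matrix.mulVec_mulVec]
    exact sum_centering_mulVec hn _
  have h3 : finrank ℝ (LinearMap.ker (centeredLin n p X ∘ₗ U.subtype)) ≤
      finrank ℝ (LinearMap.ker (centeredLin n p X) ⊓ U : Submodule ℝ _) := by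
    rw [LinearMap.ker_comp, inf_comm, ← Submodule.map_comap_subtype,
      ← (Submodule.equivMapOfInjective U.subtype U.injective_subtype
      (Submodule.comap U.subtype (LinearMap.ker (centeredLin n p X)))).finrank_eq]
  omega

/-- For almost every `X`, if the kernel of `M X` in a subspace `U` is contained in the kernel of a
functional that is nonzero on `U`, then this kernel is trivial. -/
lemma ae_ker_inf_eq_bot_of_le_ker {n p : ℕ} (hn : 1 ≤ n) (U : Submodule ℝ (Fin p → ℝ))
    (w : (Fin p → ℝ) →ₗ[ℝ] ℝ) (hw : ¬ U ≤ LinearMap.ker w) :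
    ∀ᵐ X : Fin n → Fin p → ℝ, LinearMap.ker (centeredLin n p X) ⊓ U ≤ LinearMap.ker w →
      LinearMap.ker (centeredLin n p X) ⊓ U = ⊥ := by
  rcases le_or_gt (finrank ℝ U) (n - 1) with hU | hU
  · filter_upwards [ae_ker_inf_eq_bot hn U hU] with X hX _ using hX
  have hlt : finrank ℝ (U ⊓ LinearMap.ker w : Submodule ℝ _) < finrank ℝ U :=
    Submodule.finrank_lt_finrank_of_lt (inf_lt_left.mpr hw)
  have hge : finrank ℝ U ≤ finrank ℝ (U ⊓ LinearMap.ker w : Submodule ℝ _) + 1 := by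
    have h1 := Submodule.finrank_sup_add_finrank_inf_eq U (LinearMap.ker w)
    have h2 := LinearMap.finrank_range_add_finrank_ker w
    have h3 := Submodule.finrank_le (U ⊔ LinearMap.ker w)
    have h4 := Submodule.finrank_le (LinearMap.range w)
    rw [finrank_self] at h4
    omega
  -- Generically `W` meets `ker (M X)` trivially, while `ker (M X) ⊓ U` has dimension at least `dim
  -- U - (n - 1)`. Together they would have dimension at least `dim U` inside the proper subspace `U
  -- ⊓ ker w`.
  obtain ⟨W, hWle, hW⟩ := exists_le_finrank_eq (U ⊓ LinearMap.ker w) (k := n - 1) (by omega)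
  filter_upwards [ae_ker_inf_eq_bot hn W hW.le] with X hX hker
  exfalso
  have h1 := finrank_le_finrank_ker_inf_add hn X U
  have h2 := Submodule.finrank_sup_add_finrank_inf_eq (LinearMap.ker (centeredLin n p X) ⊓ U) W
  have h3 : LinearMap.ker (centeredLin n p X) ⊓ U ⊓ W = ⊥ :=
    le_bot_iff.mp (hX ▸ inf_le_inf_right W inf_le_left)
  have h4 : finrank ℝ (LinearMap.ker (centeredLin n p X) ⊓ U ⊔ W : Submodule ℝ _) ≤
      finrank ℝ (U ⊓ LinearMap.ker w : Submodule ℝ _) :=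
    Submodule.finrank_mono (sup_le (le_inf inf_le_right hker) hWle)
  rw [h3, finrank_bot] at h2
  omega

/-! ### Existence of solutions -/

lemma norm_le_l1Norm {m : ℕ} (v : Fin m → ℝ) : ‖v‖ ≤ l1Norm v :=
  (pi_norm_le_iff_of_nonneg (Finset.sum_nonneg fun _ _ => abs_nonneg _)).mpr fun i =>
    Finset.single_le_sum (f := fun i => |v i|) (fun _ _ => abs_nonneg _) (Finset.mem_univ i)

lemma two_mul_norm_le_sqNorm_add_one {n : ℕ} (v : Fin n → ℝ) : 2 * ‖v‖ ≤ sqNorm v + 1 := by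
  have h0 : 0 ≤ sqNorm v := Finset.sum_nonneg fun _ _ => sq_nonneg _
  have : ‖v‖ ≤ (sqNorm v + 1) / 2 := by
    refine (pi_norm_le_iff_of_nonneg (by positivity)).mpr fun i => ?_
    have h : v i ^ 2 ≤ sqNorm v :=
      Finset.single_le_sum (f := fun i => v i ^ 2) (fun _ _ => sq_nonneg _) (Finset.mem_univ i)
    rw [Real.norm_eq_abs]
    nlinarith [sq_nonneg (|v i| - 1), sq_abs (v i)]
  linarith

lemma continuous_criterion {m n p : ℕ} (D : Matrix (Fin m) (Fin p) ℝ) (lam : ℝ)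
    (A : Matrix (Fin n) (Fin p) ℝ) (y : Fin n → ℝ) : Continuous (criterion D lam A y) := by
  unfold criterion sqNorm l1Norm Matrix.mulVec dotProduct
  simp only [Pi.sub_apply]
  fun_prop

lemma exists_criterion_le {m n p : ℕ} (D : Matrix (Fin m) (Fin p) ℝ) {lam : ℝ} (hlam : 0 < lam)
    (A : Matrix (Fin n) (Fin p) ℝ) (y : Fin n → ℝ)
    (hker : LinearMap.ker A.mulVecLin ⊓ LinearMap.ker D.mulVecLin = ⊥) :
    ∃ β, ∀ β', criterion D lam A y β ≤ criterion D lam A y β' := by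
  refine (continuous_criterion D lam A y).exists_forall_le ?_
  have hinj : LinearMap.ker (A.mulVecLin.prod D.mulVecLin) = ⊥ := by
    rw [LinearMap.ker_prod, hker]
  have h1 := (LinearMap.isClosedEmbedding_of_injective hinj).tendsto_cocompact
  have h2 := (tendsto_norm_cocompact_atTop.comp h1).const_mul_atTop (lt_min one_pos hlam)
  -- The criterion dominates `min 1 lam * ‖(A β, D β)‖ - (‖y‖ + 1/2)`, using `‖v‖ - 1/2 ≤ sqNorm v /
  -- 2`.
  refine Filter.tendsto_atTop_mono (fun β => ?_)
    (Filter.tendsto_atTop_add_const_right _ (-(‖y‖ + 1 / 2)) h2)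
  have h3 := two_mul_norm_le_sqNorm_add_one (y - A.mulVec β)
  have h4 := norm_le_l1Norm (D.mulVec β)
  have h5 : ‖A.mulVec β‖ ≤ ‖y‖ + ‖y - A.mulVec β‖ := by
    simpa using norm_sub_le y (y - A.mulVec β)
  have h6 : min 1 lam * ‖(A.mulVec β, D.mulVec β)‖ ≤ ‖A.mulVec β‖ + lam * ‖D.mulVec β‖ := by
    have ha := norm_nonneg (A.mulVec β)
    have hd := norm_nonneg (D.mulVec β)
    have hm : 0 < min 1 lam := lt_min one_pos hlam
    rw [Prod.norm_mk]
    rcases max_choice ‖A.mulVec β‖ ‖D.mulVec β‖ with h | h <;> rw [h]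
    · nlinarith [min_le_left 1 lam]
    · nlinarith [min_le_right 1 lam]
  have h7 := mul_le_mul_of_nonneg_left h4 hlam.le
  simp only [Function.comp_apply, LinearMap.prod_apply, Function.prod_apply,
    Matrix.mulVecLin_apply, criterion]
  linarith

/-! ### Uniqueness of solutions -/

/-- The vectors `u` such that `D u` vanishes where the sign pattern `σ` does. -/
def signSpace {m p : ℕ} (D : Matrix (Fin m) (Fin p) ℝ) (σ : Fin m → SignType) :
    Submodule ℝ (Fin p → ℝ) where
  carrier := {u | ∀ i, σ i = 0 → D.mulVec u i = 0}
  add_mem' hu hv i hi := by simp [Matrix.mulVec_add, hu i hi, hv i hi]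
  zero_mem' i _ := by simp
  smul_mem' c u hu i hi := by simp [Matrix.mulVec_smul, hu i hi]

lemma mem_signSpace {m p : ℕ} {D : Matrix (Fin m) (Fin p) ℝ} {σ : Fin m → SignType}
    {u : Fin p → ℝ} : u ∈ signSpace D σ ↔ ∀ i, σ i = 0 → D.mulVec u i = 0 := Iff.rfl

/-- The functional `u ↦ ⟨σ, D u⟩` attached to a sign pattern `σ`. -/
def signFunctional {m p : ℕ} (D : Matrix (Fin m) (Fin p) ℝ) (σ : Fin m → SignType) :
    (Fin p → ℝ) →ₗ[ℝ] ℝ :=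
  ∑ i, (σ i : ℝ) • (LinearMap.proj i ∘ₗ D.mulVecLin)

lemma signFunctional_apply {m p : ℕ} (D : Matrix (Fin m) (Fin p) ℝ) (σ : Fin m → SignType)
    (u : Fin p → ℝ) : signFunctional D σ u = ∑ i, (σ i : ℝ) * D.mulVec u i := by
  simp [signFunctional]

/-- At a minimum along a line that keeps the zero entries, the derivative of the `ℓ₁` norm
vanishes. -/
lemma sum_sign_mul_eq_zero {m : ℕ} {a b : Fin m → ℝ} (hab : ∀ i, a i = 0 → b i = 0)
    (hmin : ∀ t : ℝ, l1Norm a ≤ l1Norm (a + t • b)) :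
    ∑ i, (SignType.sign (a i) : ℝ) * b i = 0 := by
  have hd : HasDerivAt (fun t : ℝ => ∑ i, |a i + t * b i|)
      (∑ i, (SignType.sign (a i) : ℝ) * b i) 0 := by
    refine HasDerivAt.fun_sum fun i _ => ?_
    rcases eq_or_ne (a i) 0 with h | h
    -- The kink of the absolute value is harmless: this summand is constantly zero.
    · simpa [h, hab i h] using hasDerivAt_const (0 : ℝ) (0 : ℝ)
    · have h1 : HasDerivAt (fun t : ℝ => a i + t * b i) (b i) 0 := by
        simpa using ((hasDerivAt_id (0 : ℝ)).mul_const (b i)).const_add (a i)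
      have h2 : HasDerivAt (fun x : ℝ => |x|) (SignType.sign (a i) : ℝ) (a i + 0 * b i) := by
        simpa using hasDerivAt_abs h
      exact h2.comp 0 h1
  refine IsLocalMin.hasDerivAt_eq_zero (Filter.Eventually.of_forall fun t => ?_) hd
  simpa [l1Norm] using hmin t

/-- Two minimizers have equal fits, and where `D` vanishes on their midpoint it vanishes on
both. -/
lemma eq_of_minimizers {m n p : ℕ} {D : Matrix (Fin m) (Fin p) ℝ} {lam : ℝ} (hlam : 0 < lam)
    {A : Matrix (Fin n) (Fin p) ℝ} {y : Fin n → ℝ} {β₁ β₂ : Fin p → ℝ}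
    (h₁ : ∀ β', criterion D lam A y β₁ ≤ criterion D lam A y β')
    (h₂ : ∀ β', criterion D lam A y β₂ ≤ criterion D lam A y β') :
    A.mulVec β₁ = A.mulVec β₂ ∧
      ∀ i, D.mulVec ((1 / 2 : ℝ) • (β₁ + β₂)) i = 0 → D.mulVec β₁ i = 0 ∧ D.mulVec β₂ i = 0 := by
  have hm₁ := h₁ ((1 / 2 : ℝ) • (β₁ + β₂))
  have hm₂ := h₂ ((1 / 2 : ℝ) • (β₁ + β₂))
  simp only [criterion, Matrix.mulVec_smul, Matrix.mulVec_add] at hm₁ hm₂ ⊢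
  set a₁ := A.mulVec β₁
  set a₂ := A.mulVec β₂
  set d₁ := D.mulVec β₁
  set d₂ := D.mulVec β₂
  have hsq : sqNorm (y - (1 / 2 : ℝ) • (a₁ + a₂)) =
      1 / 2 * sqNorm (y - a₁) + 1 / 2 * sqNorm (y - a₂) - 1 / 4 * sqNorm (a₁ - a₂) := by
    simp only [sqNorm, Finset.mul_sum, ← Finset.sum_add_distrib, ← Finset.sum_sub_distrib]
    refine Finset.sum_congr rfl fun i _ => ?_
    simp only [Pi.sub_apply, Pi.smul_apply, Pi.add_apply, smul_eq_mul]
    ring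
  have hpt : ∀ i, 0 ≤ |d₁ i| + |d₂ i| - 2 * |((1 / 2 : ℝ) • (d₁ + d₂)) i| := fun i => by
    have := abs_add_le (d₁ i) (d₂ i)
    simp only [Pi.smul_apply, Pi.add_apply, smul_eq_mul, abs_mul]
    norm_num
    linarith
  have hl : ∑ i, (|d₁ i| + |d₂ i| - 2 * |((1 / 2 : ℝ) • (d₁ + d₂)) i|) =
      l1Norm d₁ + l1Norm d₂ - 2 * l1Norm ((1 / 2 : ℝ) • (d₁ + d₂)) := by
    simp only [l1Norm, Finset.mul_sum, ← Finset.sum_add_distrib, ← Finset.sum_sub_distrib]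
  have hl0 := Finset.sum_nonneg fun i (_ : i ∈ Finset.univ) => hpt i
  have hs0 : 0 ≤ sqNorm (a₁ - a₂) := Finset.sum_nonneg fun _ _ => sq_nonneg _
  rw [hl] at hl0
  have hkey : 1 / 4 * sqNorm (a₁ - a₂) +
      lam * (l1Norm d₁ + l1Norm d₂ - 2 * l1Norm ((1 / 2 : ℝ) • (d₁ + d₂))) ≤ 0 := by
    rw [hsq] at hm₁ hm₂
    linarith
  have hprod := mul_nonneg hlam.le hl0
  have hs : sqNorm (a₁ - a₂) = 0 := by linarith
  have hd : l1Norm d₁ + l1Norm d₂ - 2 * l1Norm ((1 / 2 : ℝ) • (d₁ + d₂)) = 0 := by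
    by_contra hne
    have := mul_pos hlam (lt_of_le_of_ne hl0 (Ne.symm hne))
    linarith
  constructor
  · ext i
    have := (Finset.sum_eq_zero_iff_of_nonneg fun _ _ => sq_nonneg _).mp hs i (Finset.mem_univ i)
    exact sub_eq_zero.mp (pow_eq_zero_iff two_ne_zero |>.mp this)
  · intro i hi
    rw [← hl] at hd
    have := (Finset.sum_eq_zero_iff_of_nonneg fun i _ => hpt i).mp hd i (Finset.mem_univ i)
    rw [hi, abs_zero] at this
    have h1 := abs_nonneg (d₁ i)
    have h2 := abs_nonneg (d₂ i)
    exact ⟨abs_eq_zero.mp (by linarith), abs_eq_zero.mp (by linarith)⟩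

/-- A minimizer is stationary along directions in the kernel of `A` that keep the zero entries of
`D β`. -/
lemma ker_inf_signSpace_le_ker {m n p : ℕ} {D : Matrix (Fin m) (Fin p) ℝ} {lam : ℝ}
    (hlam : 0 < lam) {A : Matrix (Fin n) (Fin p) ℝ} {y : Fin n → ℝ} {β : Fin p → ℝ}
    (hβ : ∀ β', criterion D lam A y β ≤ criterion D lam A y β') :
    LinearMap.ker A.mulVecLin ⊓ signSpace D (fun i => SignType.sign (D.mulVec β i)) ≤
      LinearMap.ker (signFunctional D fun i => SignType.sign (D.mulVec β i)) := by
  rintro u ⟨hA, hu⟩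
  replace hA : A.mulVec u = 0 := hA
  replace hu := mem_signSpace.mp hu
  rw [LinearMap.mem_ker, signFunctional_apply]
  refine sum_sign_mul_eq_zero (fun i hi => hu i (by simp [hi])) fun t => ?_
  have h := hβ (β + t • u)
  simp only [criterion, Matrix.mulVec_add, Matrix.mulVec_smul, hA, smul_zero, add_zero] at h
  exact le_of_mul_le_mul_left (by linarith) hlam

lemma existsUnique_criterion_le {m n p : ℕ} (D : Matrix (Fin m) (Fin p) ℝ) {lam : ℝ}
    (hlam : 0 < lam) (A : Matrix (Fin n) (Fin p) ℝ) (y : Fin n → ℝ)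
    (hker : LinearMap.ker A.mulVecLin ⊓ LinearMap.ker D.mulVecLin = ⊥)
    (hsign : ∀ σ, ¬ signSpace D σ ≤ LinearMap.ker (signFunctional D σ) →
      LinearMap.ker A.mulVecLin ⊓ signSpace D σ ≤ LinearMap.ker (signFunctional D σ) →
      LinearMap.ker A.mulVecLin ⊓ signSpace D σ = ⊥) :
    ∃! β, ∀ β', criterion D lam A y β ≤ criterion D lam A y β' := by
  refine existsUnique_of_exists_of_unique (exists_criterion_le D hlam A y hker) ?_
  intro β₁ β₂ h₁ h₂
  obtain ⟨hA, hD⟩ := eq_of_minimizers hlam h₁ h₂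
  set β := (1 / 2 : ℝ) • (β₁ + β₂) with hβdef
  have hβ : ∀ β', criterion D lam A y β ≤ criterion D lam A y β' := by
    intro β'
    refine le_trans ?_ (h₁ β')
    have hAβ : A.mulVec β = A.mulVec β₁ := by
      rw [hβdef, Matrix.mulVec_smul, Matrix.mulVec_add, ← hA]
      module
    have e₁ := h₁ β₂
    have e₂ := h₂ β₁
    simp only [criterion, ← hA, hAβ] at e₁ e₂ ⊢
    have hle : 2 * l1Norm (D.mulVec β) ≤ l1Norm (D.mulVec β₁) + l1Norm (D.mulVec β₂) := by
      simp only [l1Norm, Finset.mul_sum, ← Finset.sum_add_distrib]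
      refine Finset.sum_le_sum fun i _ => ?_
      have := abs_add_le (D.mulVec β₁ i) (D.mulVec β₂ i)
      rw [hβdef, Matrix.mulVec_smul, Matrix.mulVec_add, Pi.smul_apply, smul_eq_mul, abs_mul]
      norm_num
      linarith
    have := mul_le_mul_of_nonneg_left hle hlam.le
    linarith
  set σ : Fin m → SignType := fun i => SignType.sign (D.mulVec β i) with hσ
  have hmem : β₁ - β₂ ∈ LinearMap.ker A.mulVecLin ⊓ signSpace D σ := by
    refine ⟨?_, fun i hi => ?_⟩
    · change A.mulVec (β₁ - β₂) = 0
      rw [Matrix.mulVec_sub, hA, sub_self]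
    · obtain ⟨e₁, e₂⟩ := hD i (by simpa [hσ] using hi)
      rw [Matrix.mulVec_sub, Pi.sub_apply, e₁, e₂, sub_self]
  suffices LinearMap.ker A.mulVecLin ⊓ signSpace D σ = ⊥ by
    rw [this, Submodule.mem_bot] at hmem
    exact sub_eq_zero.mp hmem
  by_cases hw : signSpace D σ ≤ LinearMap.ker (signFunctional D σ)
  -- At `β` itself the functional takes the value `l1Norm (D β)`, so here `D β = 0`, `σ = 0`, and
  -- the sign space is `ker D`.
  · have hβmem : β ∈ signSpace D σ := fun i hi => by simpa [hσ] using hi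
    have h0 := hw hβmem
    rw [LinearMap.mem_ker, signFunctional_apply] at h0
    simp only [hσ, sign_mul_self] at h0
    have hDβ : ∀ i, D.mulVec β i = 0 := fun i => abs_eq_zero.mp <|
      (Finset.sum_eq_zero_iff_of_nonneg fun _ _ => abs_nonneg _).mp h0 i (Finset.mem_univ i)
    refine le_bot_iff.mp (hker ▸ inf_le_inf_left _ fun u hu => ?_)
    exact funext fun i => hu i (by simp [hσ, hDβ i])
  · exact hsign σ hw (ker_inf_signSpace_le_ker hlam hβ)

/-! ### The intercept -/

/-- Pythagoras: split the residual into its centered part and its mean. The constant appears because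
the centered problem leaves `y` uncentered. -/
lemma interceptCriterion_eq {m n p : ℕ} (hn : 1 ≤ n) (D : Matrix (Fin m) (Fin p) ℝ) (lam : ℝ)
    (X : Matrix (Fin n) (Fin p) ℝ) (y : Fin n → ℝ) (b : ℝ × (Fin p → ℝ)) :
    interceptCriterion D lam X y b = criterion D lam (centering n * X) y b.2 -
      (∑ i, y i) ^ 2 / (2 * n) +
      n / 2 * (b.1 - (n : ℝ)⁻¹ * ∑ i, (y i - X.mulVec b.2 i)) ^ 2 := by
  have hn0 : (n : ℝ) ≠ 0 := by positivity
  have key : ∀ (c : ℝ) (r : Fin n → ℝ),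
      ∑ i, (r i - c) ^ 2 = ∑ i, r i ^ 2 - 2 * c * ∑ i, r i + n * c ^ 2 := fun c r => by
    simp only [sub_sq, Finset.sum_add_distrib, Finset.sum_sub_distrib, Finset.sum_const,
      Finset.card_univ, Fintype.card_fin, nsmul_eq_mul, ← Finset.sum_mul, ← Finset.mul_sum]
    ring
  have h1 := key b.1 (fun i => y i - X.mulVec b.2 i)
  have h2 := key (-((n : ℝ)⁻¹ * ∑ j, X.mulVec b.2 j)) (fun i => y i - X.mulVec b.2 i)
  have e1 : sqNorm (y - b.1 • (1 : Fin n → ℝ) - X.mulVec b.2) =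
      ∑ i, (y i - X.mulVec b.2 i - b.1) ^ 2 :=
    Finset.sum_congr rfl fun i _ => by simp; ring
  have e2 : sqNorm (y - (centering n * X).mulVec b.2) =
      ∑ i, (y i - X.mulVec b.2 i - -((n : ℝ)⁻¹ * ∑ j, X.mulVec b.2 j)) ^ 2 :=
    Finset.sum_congr rfl fun i _ => by
      rw [← Matrix.mulVec_mulVec, Pi.sub_apply, centering_mulVec_apply]; ring
  rw [interceptCriterion, criterion, e1, e2, h1, h2]
  simp only [Finset.sum_sub_distrib]
  field_simp
  ring

/-- For fixed `β` the mean of `y - X β` is the unique optimal intercept, and it leaves the centered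
criterion up to a constant. -/
lemma existsUnique_isInterceptSolution {m n p : ℕ} (hn : 1 ≤ n) {D : Matrix (Fin m) (Fin p) ℝ}
    {lam : ℝ} {X : Matrix (Fin n) (Fin p) ℝ} {y : Fin n → ℝ}
    (h : ∃! β, IsCenteredSolution D lam X y β) : ∃! b, IsInterceptSolution D lam X y b := by
  have hn0 : (0 : ℝ) < n := by positivity
  obtain ⟨β, hβ, huniq⟩ := h
  refine ⟨((n : ℝ)⁻¹ * ∑ i, (y i - X.mulVec β i), β), fun b' => ?_, fun b hb => ?_⟩
  · rw [interceptCriterion_eq hn, interceptCriterion_eq hn]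
    have h1 := hβ b'.2
    have h2 : 0 ≤ (n : ℝ) / 2 * (b'.1 - (n : ℝ)⁻¹ * ∑ i, (y i - X.mulVec b'.2 i)) ^ 2 := by
      positivity
    simp only [sub_self]
    linarith
  · have hnn : 0 ≤ (n : ℝ) / 2 * (b.1 - (n : ℝ)⁻¹ * ∑ i, (y i - X.mulVec b.2 i)) ^ 2 := by
      positivity
    have hb2 : b.2 = β := by
      refine huniq _ fun β' => ?_
      have h1 := hb ((n : ℝ)⁻¹ * ∑ i, (y i - X.mulVec β' i), β')
      rw [interceptCriterion_eq hn, interceptCriterion_eq hn] at h1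
      simp only [sub_self] at h1
      linarith
    have h1 := hb ((n : ℝ)⁻¹ * ∑ i, (y i - X.mulVec b.2 i), b.2)
    rw [interceptCriterion_eq hn, interceptCriterion_eq hn] at h1
    simp only [sub_self] at h1
    have h2 : (b.1 - (n : ℝ)⁻¹ * ∑ i, (y i - X.mulVec b.2 i)) ^ 2 = 0 := by
      have : 0 ≤ (b.1 - (n : ℝ)⁻¹ * ∑ i, (y i - X.mulVec b.2 i)) ^ 2 := sq_nonneg _
      nlinarith
    have h3 := sub_eq_zero.mp (pow_eq_zero_iff two_ne_zero |>.mp h2)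
    rw [hb2] at h3
    exact Prod.ext h3 hb2

/-! ### Almost sure uniqueness -/

/-- For almost every `X`, the centered problem has exactly one solution for every `y`. -/
lemma ae_existsUnique_isCenteredSolution {m n p : ℕ} (hn : 1 ≤ n) (D : Matrix (Fin m) (Fin p) ℝ)
    {lam : ℝ} (hlam : 0 < lam) (hD : nullity D ≤ n - 1) :
    ∀ᵐ X : Fin n → Fin p → ℝ, ∀ y, ∃! β, IsCenteredSolution D lam (Matrix.of X) y β := by
  have hsign : ∀ᵐ X : Fin n → Fin p → ℝ, ∀ σ,
      ¬ signSpace D σ ≤ LinearMap.ker (signFunctional D σ) →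
      LinearMap.ker (centeredLin n p X) ⊓ signSpace D σ ≤ LinearMap.ker (signFunctional D σ) →
      LinearMap.ker (centeredLin n p X) ⊓ signSpace D σ = ⊥ := by
    refine ae_all_iff.mpr fun σ => ?_
    by_cases hw : signSpace D σ ≤ LinearMap.ker (signFunctional D σ)
    · exact Filter.Eventually.of_forall fun _ h => absurd hw h
    · filter_upwards [ae_ker_inf_eq_bot_of_le_ker hn _ _ hw] with X hX _ using hX
  filter_upwards [hsign, ae_ker_inf_eq_bot hn (LinearMap.ker D.mulVecLin) hD] with X hX hker y
  exact existsUnique_criterion_le D hlam _ y hker hX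

end GenLasso

theorem mainTheorem8 {Ω : Type*} [MeasurableSpace Ω] (P : Measure Ω) [IsProbabilityMeasure P]
    {m n p : ℕ} (D : Matrix (Fin m) (Fin p) ℝ) (lam : ℝ) (hlam : 0 < lam)
    (X : Ω → Matrix (Fin n) (Fin p) ℝ) (y : Ω → Fin n → ℝ)
    (hmeas : AEMeasurable (GenLasso.jointVec X y) P)
    (hac : P.map (GenLasso.jointVec X y) ≪ volume)
    (hdim : (p : ℤ) ≤ (n : ℤ) - 1 ∨
      ((n : ℤ) - 1 < (p : ℤ) ∧ (GenLasso.nullity D : ℤ) ≤ (n : ℤ) - 1)) :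
    (∀ᵐ ω ∂P, ∃! β : Fin p → ℝ, GenLasso.IsCenteredSolution D lam (X ω) (y ω) β) ∧
    (∀ᵐ ω ∂P, ∃! b : ℝ × (Fin p → ℝ), GenLasso.IsInterceptSolution D lam (X ω) (y ω) b) := by
  -- The integer bounds in `hdim` exclude `n = 0`, as `p` and the nullity are nonnegative.
  have hn : 1 ≤ n := by omega
  have hD : GenLasso.nullity D ≤ n - 1 := by
    have h : GenLasso.nullity D ≤ p := by
      simpa [GenLasso.nullity] using Submodule.finrank_le (LinearMap.ker D.mulVecLin)
    omega
  have hvol : ∀ᵐ z : (Fin n → Fin p → ℝ) × (Fin n → ℝ), ∀ y,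
      ∃! β, GenLasso.IsCenteredSolution D lam (Matrix.of z.1) y β :=
    Measure.quasiMeasurePreserving_fst.ae (GenLasso.ae_existsUnique_isCenteredSolution hn D hlam hD)
  have ha : ∀ᵐ ω ∂P, ∃! β : Fin p → ℝ, GenLasso.IsCenteredSolution D lam (X ω) (y ω) β := by
    filter_upwards [ae_of_ae_map hmeas (hac.ae_le hvol)] with ω hω using hω (y ω)
  exact ⟨ha, ha.mono fun ω => GenLasso.existsUnique_isInterceptSolution hn⟩
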